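/- Let $HP(U,A)$ be an $M$-agent Hawkes process on $[0,T]$ with $C$ entities: the agents are independent, and the events of entity $c$ of agent $m$ have, given the agent's own history, the conditional intensity $$\lambda_c^m(t)=\mu_c^m+\sum_{(t_i,c_i)\in s^m,\ t_i<t}\phi_{cc_i}(t-t_i),\qquad \phi_{cc'}=\sum_{l=1}^L a_{cc'l}\,g_l ,$$ with $U=[\mu_c^m]\ge 0$ of size $C\times M$, $A=[a_{cc'l}]\ge 0$ and measurable kernels $g_l\ge 0$. Let $s^m$ be the event sequence of agent $m$. Assume $\|U\|_F^2\le U_0$, $\|A\|_F^2\le A_0$, $g_l^2\le G$ on $[0,T]$, and let $\lambda_0>0$, $0<\delta<\tfrac12$. For $M$ event sequences $s=(s^1,\dots,s^M)$ with $I_\Sigma$ events in total and at most $I$ events per sequence, the (excess) risk bound, at confidence $1-2\delta$ and up to a universal constant factor, for learning an $M$-agent process whose parameters are bounded by $U_0,A_0$ and whose intensities are bounded below by $\lambda_0$ is $$\mathcal B_M(s;U_0,\lambda_0)=\frac{R\,\tau\,\bigl(D\log I_\Sigma+\log\frac2\delta\bigr)}{I_\Sigma},\qquad R=U_0+A_0,\quad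 \tau=\Bigl(\frac{LGI}{\lambda_0}\Bigr)^2,\quad D=C(M+CL),$$ read as $0$ if $I_\Sigma=0$. A $K$-nonaugmented superposition is given by a matrix $P\in\{0,1\}^{M\times M'}$ whose row sums are all $1$ and whose largest column sum is $K$; here $M'\le M$. The new sequence $s'^{m'}$ merges the events of all $s^m$ with $P_{mm'}=1$. Suppose that the columns $\mu^m$ of $U$ are pairwise orthogonal: $(\mu^m)^\top\mu^{n}=0$ for $m\ne n$. Then for every $K$-nonaugmented superposition: 1. the superposed sequences $s'$ form an $M'$-agent Hawkes process $HP(U',A)$ with $U'=UP$ and the same kernels; 2. $\|U'\|_F^2=\|U\|_F^2$, so $HP(U',A)$ satisfies the same parameter and kernel bounds, with $U_0'=U_0$; 3. if every column sum of $P$ is $K$, then at any time $t$ and for any entity $c$ with $\lambda_c^m(t)\ge\lambda_0$ for all $m$, the intensities of the superposed process satisfy $\lambda_c'^{m'}(t)\ge K\lambda_0$ for all $m'$; 4. for every realization, with $I_\Sigma$ the number of observed events, the inequality $$U_0'\le (A_0+U_0)\,\frac{(M+CL)\log I_\Sigma+\log\frac2\delta}{(M'+CL)\log I_\Sigma+\log\frac2\delta}-A_0$$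 holds with $U_0'=U_0$, and the risk bound for learning from the superposition, with the intensity lower bound $K\lambda_0$, is tighter: $$\mathcal B_{M'}(s';U_0,K\lambda_0)\le\mathcal B_M(s;U_0,\lambda_0),$$ with strict inequality if $M'<M$, $I_\Sigma\ge2$, $L\ge1$, $G>0$ and $U_0+A_0>0$. -/

import Mathlib

open MeasureTheory ProbabilityTheory Matrix

noncomputable section

/-- Parameters of an `M`-agent Hawkes process with `C` entities and `L` basis kernels: the exogenous
intensity matrix `U` (its `m`-th column is the vector of agent `m`), the endogenous impact tensor
`A`, shared by all agents, and the predefined nonnegative kernels `g`. -/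
structure HawkesModel (C L M : ℕ) where
  U : Matrix (Fin C) (Fin M) ℝ
  A : Fin C → Fin C → Fin L → ℝ
  g : Fin L → ℝ → ℝ
  U_nonneg : ∀ c m, 0 ≤ U c m
  A_nonneg : ∀ c c' l, 0 ≤ A c c' l
  g_nonneg : ∀ l t, 0 ≤ t → 0 ≤ g l t
  g_measurable : ∀ l, Measurable (g l)

/-- An event sequence: a finite collection of events `(time, entity)`, counted with multiplicity. -/
abbrev EventSeq (C : ℕ) := Multiset (ℝ × Fin C)

/-- The counting function: the number of events of entity `c` up to and including time `t`. -/
def EventSeq.count {C : ℕ} (s : EventSeq C) (c : Fin C) (t : ℝ) : ℕ :=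
  Multiset.card (s.filter fun e => e.1 ≤ t ∧ e.2 = c)

/-- The history of a random event sequence up to time `t`: the sigma-algebra generated by its
counting functions at times `r ≤ t`. -/
@[reducible] def eventHistory {C : ℕ} {Ω : Type*} (N : Ω → EventSeq C) (t : ℝ) : MeasurableSpace Ω :=
  ⨆ (c : Fin C) (r : ℝ) (_ : r ≤ t), MeasurableSpace.comap (fun ω => (N ω).count c r) ⊤

/-- Total number of events of a family of event sequences. -/
def totalEvents {C M : ℕ} (s : Fin M → EventSeq C) : ℕ := ∑ m, Multiset.card (s m)

/-- Maximal number of events per sequence. -/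
def maxEvents {C M : ℕ} (s : Fin M → EventSeq C) : ℕ :=
  Finset.univ.sup fun m => Multiset.card (s m)

/-- Squared Frobenius norm. -/
def frobSq {C M : ℕ} (U : Matrix (Fin C) (Fin M) ℝ) : ℝ := ∑ c, ∑ m, U c m ^ 2

namespace HawkesModel

variable {C L M : ℕ}

/-- The impact function of entity `c'` on entity `c`. -/
def impact (H : HawkesModel C L M) (c c' : Fin C) (t : ℝ) : ℝ := ∑ l, H.A c c' l * H.g l t

/-- The intensity of entity `c` for agent `m` at time `t`, when `s` is the event sequence of the
agent; only the events strictly before `t` matter. -/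
def intensity (H : HawkesModel C L M) (s : EventSeq C) (m : Fin M) (c : Fin C) (t : ℝ) : ℝ :=
  H.U c m + ((s.filter fun e => e.1 < t).map fun e => H.impact c e.2 (t - e.1)).sum

/-- The random event sequences `N m`, `m = 1, …, M`, form an `M`-agent Hawkes process on `[0, T]`
with the given parameters: the agents are independent, each `N m` is almost surely a simple point
process without event at time zero, with finitely many expected events, and the conditional
intensity of its events of entity `c`, given the own history of agent `m`, is `H.intensity`. -/
structure IsHawkes (H : HawkesModel C L M) (T : ℝ) {Ω : Type*} [MeasurableSpace Ω]
    (N : Fin M → Ω → EventSeq C) (Pr : Measure Ω) : Prop where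
  measurable_count : ∀ m c t, Measurable fun ω => (N m ω).count c t
  mem_window : ∀ m, ∀ᵐ ω ∂Pr, ∀ e ∈ N m ω, e.1 ∈ Set.Ioc 0 T
  simple : ∀ m, ∀ᵐ ω ∂Pr, ((N m ω).map Prod.fst).Nodup
  finite_mean : ∀ m c, ∫⁻ ω, ((N m ω).count c T : ENNReal) ∂Pr ≠ ⊤
  has_intensity : ∀ m c s t, 0 ≤ s → s ≤ t → t ≤ T →
    ∀ B : Set Ω, MeasurableSet[eventHistory (N m) s] B →
      ∫⁻ ω in B, (((N m ω).count c t - (N m ω).count c s : ℕ) : ENNReal) ∂Pr =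
        ∫⁻ ω in B, (∫⁻ u in Set.Ioc s t, ENNReal.ofReal (H.intensity (N m ω) m c u)) ∂Pr
  indep : iIndepFun (fun m ω (p : Fin C × ℝ) => (N m ω).count p.1 p.2) Pr

/-- The boundedness constraints on the parameters and on the kernels. -/
structure BoundedBy (H : HawkesModel C L M) (T U0 A0 G : ℝ) : Prop where
  U_le : frobSq H.U ≤ U0
  A_le : ∑ c, ∑ c', ∑ l, H.A c c' l ^ 2 ≤ A0
  g_le : ∀ l, ∀ t ∈ Set.Icc 0 T, H.g l t ^ 2 ≤ G

/-- The exogenous intensity vectors of different agents are orthogonal. -/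
def OrthogonalExogenous (H : HawkesModel C L M) : Prop :=
  ∀ m n : Fin M, m ≠ n → (fun c => H.U c m) ⬝ᵥ (fun c => H.U c n) = 0

/-- The superposed model, with exogenous intensity matrix `U P` and unchanged `A` and kernels. -/
def superpose (H : HawkesModel C L M) {M' : ℕ} (P : Matrix (Fin M) (Fin M') ℕ) :
    HawkesModel C L M' where
  U := H.U * P.map (Nat.cast : ℕ → ℝ)
  A := H.A
  g := H.g
  U_nonneg c m' := by
    rw [Matrix.mul_apply]
    exact Finset.sum_nonneg fun m _ => mul_nonneg (H.U_nonneg c m) (Nat.cast_nonneg _)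
  A_nonneg := H.A_nonneg
  g_nonneg := H.g_nonneg
  g_measurable := H.g_measurable

end HawkesModel

/-- The superposed event sequences: sequence `m'` collects all the events of the agents `m` with
`P m m' = 1`. -/
def superposeEvents {C M M' : ℕ} (P : Matrix (Fin M) (Fin M') ℕ) (s : Fin M → EventSeq C) :
    Fin M' → EventSeq C :=
  fun m' => ∑ m, P m m' • s m

/-- `P` describes a `K`-nonaugmented superposition: it is binary, its largest column sum is `K`,
and all its row sums are one. -/
structure IsNonaugmented {M M' : ℕ} (P : Matrix (Fin M) (Fin M') ℕ) (K : ℕ) : Prop where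
  binary : ∀ m m', P m m' = 0 ∨ P m m' = 1
  col_sums : IsGreatest (Set.range ((1 : Fin M → ℕ) ᵥ* P)) K
  row_sums : P *ᵥ (1 : Fin M' → ℕ) = 1

/-- The dimension `C (M + C L)` of the parameter vector. -/
def paramDim (C L M : ℕ) : ℕ := C * (M + C * L)

/-- The smoothness constant `(L G I / lam0) ^ 2`, with `lam0` the positive lower bound imposed on the
learned intensities and `I` the maximal number of events per
sequence. -/
def smoothness (L : ℕ) {C M : ℕ} (s : Fin M → EventSeq C) (G lam0 : ℝ) : ℝ :=
  (L * G * maxEvents s / lam0) ^ 2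

/-- The excess risk bound (up to a universal constant factor) for learning an `M`-agent Hawkes
process with `C` entities and `L` kernels from the event sequences `s`, at confidence `1 - 2 δ`:
`R τ (D log I + log (2 / δ)) / I`, with `R = U0 + A0`, the smoothness constant `τ`, the dimension
`D`, and the total number `I` of events. -/
def riskBound (L : ℕ) {C M : ℕ} (s : Fin M → EventSeq C) (U0 A0 G lam0 δ : ℝ) : ℝ :=
  (U0 + A0) * smoothness L s G lam0 *
    (paramDim C L M * Real.log (totalEvents s) + Real.log (2 / δ)) / totalEvents s

/-- The sufficient condition for tightening, on the bound `U0'` for the squared Frobenius norm of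
the superposed exogenous intensity matrix; `n` is the total number of events. -/
def TighteningCondition (C L M M' n : ℕ) (U0 U0' A0 δ : ℝ) : Prop :=
  U0' ≤ (A0 + U0) *
    (((M + C * L : ℕ) * Real.log n + Real.log (2 / δ)) /
      ((M' + C * L : ℕ) * Real.log n + Real.log (2 / δ))) - A0

end

/-! The impact tensor and the kernels are shared by all agents, and the excitation is additive over
events. Hence the intensity of a merged sequence is the sum of the intensities of its parts
(`intensity_superposeEvents`), which also gives the factor `K` in the lower bound.

Three properties of the superposed process need probability. The compensator identity of an agent
must hold on the joint history of all agents: enlarging a history by independent information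
preserves it (`setLIntegral_eq_of_indep`), and the merged history is coarser than the joint one.
Simplicity requires that distinct agents almost surely never fire together: they are independent and
event times have no fixed atoms (`IsHawkes.ae_times_ne`). Independence passes to disjoint blocks
(`iIndep_iSup_fiber`).

Orthogonality kills the cross terms of the Frobenius norm. In the risk bound, the total number of
events is unchanged, the longest sequence grows at most by the factor `K` that the intensity bound
gains, and the dimension does not increase. -/

open Filter Topology

/-! ### Event sequences as random counting measures on the line. -/

namespace EventSeq

variable {C : ℕ}

/-- The counting measure on the event times of entity `c`. -/
noncomputable def timeMeasure (s : EventSeq C) (c : Fin C) : Measure ℝ :=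
  ((s.filter fun e => e.2 = c).map fun e => Measure.dirac e.1).sum

theorem lintegral_timeMeasure (s : EventSeq C) (c : Fin C) (f : ℝ → ENNReal) :
    ∫⁻ t, f t ∂s.timeMeasure c = ((s.filter fun e => e.2 = c).map fun e => f e.1).sum := by
  unfold timeMeasure
  induction s using Multiset.induction_on with
  | empty => simp
  | cons e s ih =>
    by_cases h : e.2 = c
    · rw [Multiset.filter_cons_of_pos (p := fun e : ℝ × Fin C => e.2 = c) s h]
      simp only [Multiset.map_cons, Multiset.sum_cons]
      rw [lintegral_add_measure, ih, lintegral_dirac]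
    · rw [Multiset.filter_cons_of_neg (p := fun e : ℝ × Fin C => e.2 = c) s h]
      exact ih

theorem timeMeasure_apply (s : EventSeq C) (c : Fin C) {A : Set ℝ} (hA : MeasurableSet A)
    [DecidablePred (· ∈ A)] :
    s.timeMeasure c A = Multiset.card (s.filter fun e => e.1 ∈ A ∧ e.2 = c) := by
  rw [← lintegral_indicator_one hA, lintegral_timeMeasure]
  induction s using Multiset.induction_on with
  | empty => simp
  | cons e s ih =>
    by_cases h : e.2 = c <;> by_cases h' : e.1 ∈ A <;>
      simp_all [Set.indicator, add_comm]

theorem timeMeasure_Iic (s : EventSeq C) (c : Fin C) (t : ℝ) :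
    s.timeMeasure c (Set.Iic t) = s.count c t := by
  classical
  rw [timeMeasure_apply s c measurableSet_Iic]
  unfold EventSeq.count
  congr 2

instance (s : EventSeq C) (c : Fin C) : IsFiniteMeasure (s.timeMeasure c) := by
  classical
  refine ⟨?_⟩
  rw [timeMeasure_apply s c MeasurableSet.univ]
  exact ENNReal.natCast_lt_top _

theorem count_mono (s : EventSeq C) (c : Fin C) : Monotone (s.count c) := by
  intro a b h
  exact Multiset.card_le_card (Multiset.monotone_filter_right s fun e he => ⟨he.1.trans h, he.2⟩)

theorem timeMeasure_Ioc (s : EventSeq C) (c : Fin C) {a b : ℝ} (h : a ≤ b) :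
    s.timeMeasure c (Set.Ioc a b) = ((s.count c b - s.count c a : ℕ) : ENNReal) := by
  rw [← Set.Iic_sdiff_Iic, measure_sdiff (Set.Iic_subset_Iic.2 h)
    measurableSet_Iic.nullMeasurableSet (measure_ne_top _ _), timeMeasure_Iic, timeMeasure_Iic,
    ENNReal.natCast_sub]

theorem one_le_timeMeasure {s : EventSeq C} {e : ℝ × Fin C} (he : e ∈ s) :
    1 ≤ s.timeMeasure e.2 {e.1} := by
  classical
  rw [timeMeasure_apply s e.2 (measurableSet_singleton _)]
  have : 0 < Multiset.card (s.filter fun e' => e'.1 ∈ ({e.1} : Set ℝ) ∧ e'.2 = e.2) :=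
    Multiset.card_pos_iff_exists_mem.2 ⟨e, by simp [he]⟩
  exact_mod_cast this

/-- Half-lines form a generating π-system, so the counts determine the measure. The sigma-algebra on
`Ω` is left free so that it can be the history of a single agent. -/
theorem measurable_timeMeasure {Ω : Type*} [MeasurableSpace Ω] {N : Ω → EventSeq C} (c : Fin C)
    (hN : ∀ t, Measurable fun ω => (N ω).count c t) :
    Measurable fun ω => (N ω).timeMeasure c := by
  have hIic : ∀ t, Measurable fun ω => (N ω).timeMeasure c (Set.Iic t) := fun t => by
    simp_rw [timeMeasure_Iic]
    exact (measurable_from_top (f := fun n : ℕ => (n : ENNReal))).comp (hN t)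
  refine Measurable.measure_of_isPiSystem (borel_eq_generateFrom_Iic ℝ ▸ BorelSpace.measurable_eq)
    isPiSystem_Iic ?_ ?_
  · rintro _ ⟨t, rfl⟩
    exact hIic t
  · have : ∀ ω, (N ω).timeMeasure c Set.univ = ⨆ n : ℕ, (N ω).timeMeasure c (Set.Iic (n : ℝ)) := by
      intro ω
      have hU : (⋃ n : ℕ, Set.Iic (n : ℝ)) = Set.univ :=
        Set.eq_univ_of_forall fun x => Set.mem_iUnion.2 (exists_nat_ge x)
      rw [← hU]
      exact Monotone.measure_iUnion fun a b h => Set.Iic_subset_Iic.2 (Nat.cast_le.2 h)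
    simp_rw [this]
    exact Measurable.iSup fun n => hIic n

end EventSeq

/-! ### Joint measurability of the intensity. -/

/-- The number of events has no uniform bound, so the counting kernels need not be finite kernels.
Cutting the source space by the integer part of the total mass leaves pieces with mass at most `n +
1`. -/
theorem isSFiniteKernel_of_isFiniteMeasure {α β : Type*} [MeasurableSpace α] [MeasurableSpace β]
    (κ : Kernel α β) (h : ∀ a, IsFiniteMeasure (κ a)) : IsSFiniteKernel κ := by
  classical
  let f : α → ℕ := fun a => ⌊(κ a Set.univ).toReal⌋₊
  have hf : Measurable f :=
    Nat.measurable_floor.comp (κ.measurable_coe MeasurableSet.univ).ennreal_toReal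
  have hs : ∀ n, MeasurableSet (f ⁻¹' {n}) := fun n => hf (measurableSet_singleton n)
  refine ⟨fun n => Kernel.piecewise (hs n) κ 0, fun n => ?_, ?_⟩
  · refine ⟨⟨n + 1, by finiteness, fun a => ?_⟩⟩
    rw [Kernel.piecewise_apply]
    split_ifs with ha
    · have h1 : (κ a Set.univ).toReal ≤ (n + 1 : ℝ) := by
        have := Nat.lt_floor_add_one (κ a Set.univ).toReal
        have e : ⌊(κ a Set.univ).toReal⌋₊ = n := ha
        rw [e] at this
        exact this.le
      rw [← ENNReal.ofReal_toReal (measure_ne_top (κ a) Set.univ)]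
      refine (ENNReal.ofReal_le_ofReal h1).trans ?_
      rw [ENNReal.ofReal_add (by positivity) (by positivity)]
      simp
    · simp
  · ext a A hA
    rw [Kernel.sum_apply' _ _ hA, tsum_eq_single (f a)]
    · simp [Kernel.piecewise_apply]
    · intro n hn
      rw [Kernel.piecewise_apply, if_neg]
      · simp
      · simpa [eq_comm] using hn

namespace HawkesModel
variable {C L M : ℕ}

theorem impact_nonneg (H : HawkesModel C L M) (c c' : Fin C) {t : ℝ} (ht : 0 ≤ t) :
    0 ≤ H.impact c c' t :=
  Finset.sum_nonneg fun l _ => mul_nonneg (H.A_nonneg c c' l) (H.g_nonneg l t ht)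

theorem measurable_impact (H : HawkesModel C L M) (c c' : Fin C) : Measurable (H.impact c c') :=
  Finset.measurable_sum _ fun l _ => (H.g_measurable l).const_mul _

theorem intensity_nonneg (H : HawkesModel C L M) (s : EventSeq C) (m : Fin M) (c : Fin C) (t : ℝ) :
    0 ≤ H.intensity s m c t := by
  refine add_nonneg (H.U_nonneg c m) (Multiset.sum_nonneg fun x hx => ?_)
  obtain ⟨e, he, rfl⟩ := Multiset.mem_map.1 hx
  exact H.impact_nonneg _ _ (sub_nonneg.2 (Multiset.mem_filter.1 he).2.le)

/-- As an integral against the counting measures, the intensity inherits measurability in sample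
point and time from kernel integration. Each event is seen by exactly one of the `C` measures. -/
theorem ofReal_intensity (H : HawkesModel C L M) (s : EventSeq C) (m : Fin M) (c : Fin C) (u : ℝ) :
    ENNReal.ofReal (H.intensity s m c u) = ENNReal.ofReal (H.U c m) +
      ∑ c', ∫⁻ τ, (if τ < u then ENNReal.ofReal (H.impact c c' (u - τ)) else 0)
        ∂s.timeMeasure c' := by
  simp_rw [EventSeq.lintegral_timeMeasure]
  induction s using Multiset.induction_on with
  | empty => simp [intensity]
  | cons e s ih =>
    have h1 : H.intensity (e ::ₘ s) m c u = H.intensity s m c u +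
        if e.1 < u then H.impact c e.2 (u - e.1) else 0 := by
      unfold intensity
      by_cases h : e.1 < u
      · simp [Multiset.filter_cons_of_pos, h]; ring
      · simp [Multiset.filter_cons_of_neg, h]
    have h2 : ∀ c' : Fin C, ((Multiset.filter (fun e => e.2 = c') (e ::ₘ s)).map fun e =>
        if e.1 < u then ENNReal.ofReal (H.impact c c' (u - e.1)) else 0).sum =
        ((Multiset.filter (fun e => e.2 = c') s).map fun e =>
        if e.1 < u then ENNReal.ofReal (H.impact c c' (u - e.1)) else 0).sum +
        if e.2 = c' then (if e.1 < u then ENNReal.ofReal (H.impact c c' (u - e.1)) else 0)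
          else 0 := by
      intro c'
      by_cases h : e.2 = c'
      · rw [Multiset.filter_cons_of_pos (p := fun e : ℝ × Fin C => e.2 = c') s h, if_pos h,
          Multiset.map_cons, Multiset.sum_cons, add_comm]
      · rw [Multiset.filter_cons_of_neg (p := fun e : ℝ × Fin C => e.2 = c') s h, if_neg h, add_zero]
    rw [h1, ENNReal.ofReal_add (H.intensity_nonneg _ _ _ _), ih]
    · simp_rw [h2]
      rw [Finset.sum_add_distrib, Finset.sum_ite_eq, if_pos (Finset.mem_univ _), add_assoc]
      split_ifs <;> simp
    · split_ifs with h
      · exact H.impact_nonneg _ _ (sub_nonneg.2 h.le)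
      · exact le_rfl

theorem measurable_ofReal_intensity {Ω : Type*} [MeasurableSpace Ω] {N : Ω → EventSeq C}
    (hN : ∀ c t, Measurable fun ω => (N ω).count c t) (H : HawkesModel C L M) (m : Fin M)
    (c : Fin C) :
    Measurable fun p : Ω × ℝ => ENNReal.ofReal (H.intensity (N p.1) m c p.2) := by
  simp_rw [ofReal_intensity]
  refine Measurable.const_add (Finset.measurable_sum _ fun c' _ => ?_) _
  let κ : Kernel Ω ℝ := ⟨_, EventSeq.measurable_timeMeasure c' (hN c')⟩
  have : IsSFiniteKernel κ := isSFiniteKernel_of_isFiniteMeasure κ fun ω =>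
    inferInstanceAs (IsFiniteMeasure ((N ω).timeMeasure c'))
  have hf : Measurable fun q : (Ω × ℝ) × ℝ =>
      if q.2 < q.1.2 then ENNReal.ofReal (H.impact c c' (q.1.2 - q.2)) else 0 := by
    refine Measurable.ite (measurableSet_lt measurable_snd measurable_fst.snd) ?_ measurable_const
    exact ((H.measurable_impact c c').comp
      (measurable_fst.snd.sub measurable_snd)).ennreal_ofReal
  exact hf.lintegral_kernel_prod_right' (κ := Kernel.prodMkRight ℝ κ)

theorem measurable_ofReal_intensity_time (H : HawkesModel C L M) (s : EventSeq C) (m : Fin M)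
    (c : Fin C) : Measurable fun u => ENNReal.ofReal (H.intensity s m c u) := by
  have h := measurable_ofReal_intensity (Ω := Unit) (N := fun _ => s) (fun _ _ => measurable_const)
    H m c
  have hmk : Measurable fun u : ℝ => ((), u) := measurable_prodMk_left
  intro A hA
  exact hmk (h hA)

theorem measurable_lintegral_intensity {Ω : Type*} [MeasurableSpace Ω] {N : Ω → EventSeq C}
    (hN : ∀ c t, Measurable fun ω => (N ω).count c t) (H : HawkesModel C L M) (m : Fin M)
    (c : Fin C) (A : Set ℝ) :
    Measurable fun ω => ∫⁻ u in A, ENNReal.ofReal (H.intensity (N ω) m c u) :=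
  (measurable_ofReal_intensity hN H m c).lintegral_prod_right'

end HawkesModel

/-! ### Consequences of independence. -/

section Independence

variable {Ω : Type*}

theorem isPiSystem_inter_measurableSet (m₁ m₂ : MeasurableSpace Ω) :
    IsPiSystem {B | ∃ A₁ A₂, MeasurableSet[m₁] A₁ ∧ MeasurableSet[m₂] A₂ ∧ B = A₁ ∩ A₂} := by
  rintro _ ⟨A₁, A₂, h₁, h₂, rfl⟩ _ ⟨A₁', A₂', h₁', h₂', rfl⟩ -
  exact ⟨A₁ ∩ A₁', A₂ ∩ A₂', h₁.inter h₁', h₂.inter h₂', Set.inter_inter_inter_comm _ _ _ _⟩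

theorem sup_eq_generateFrom_inter (m₁ m₂ : MeasurableSpace Ω) :
    m₁ ⊔ m₂ = MeasurableSpace.generateFrom
      {B | ∃ A₁ A₂, MeasurableSet[m₁] A₁ ∧ MeasurableSet[m₂] A₂ ∧ B = A₁ ∩ A₂} := by
  refine le_antisymm (sup_le (fun A hA => ?_) fun A hA => ?_)
    (MeasurableSpace.generateFrom_le ?_)
  · exact MeasurableSpace.measurableSet_generateFrom
      ⟨A, Set.univ, hA, MeasurableSet.univ, (Set.inter_univ A).symm⟩
  · exact MeasurableSpace.measurableSet_generateFrom
      ⟨Set.univ, A, MeasurableSet.univ, hA, (Set.univ_inter A).symm⟩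
  · rintro _ ⟨A₁, A₂, h₁, h₂, rfl⟩
    exact MeasurableSet.inter ((le_sup_left : m₁ ≤ m₁ ⊔ m₂) _ h₁)
      ((le_sup_right : m₂ ≤ m₁ ⊔ m₂) _ h₂)

theorem setLIntegral_inter_of_indep {mF mJ : MeasurableSpace Ω} [mΩ : MeasurableSpace Ω]
    {μ : Measure Ω} (hF : mF ≤ mΩ) (hJ : mJ ≤ mΩ) (hind : Indep mF mJ μ) {f : Ω → ENNReal}
    (hf : Measurable[mF] f) {A B : Set Ω} (hA : MeasurableSet[mF] A) (hB : MeasurableSet[mJ] B) :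
    ∫⁻ ω in A ∩ B, f ω ∂μ = (∫⁻ ω in A, f ω ∂μ) * μ B := by
  have h1 : Measurable[mJ] (1 : Ω → ENNReal) := @measurable_const _ _ _ mJ 1
  rw [← lintegral_indicator ((hF _ hA).inter (hJ _ hB)), ← lintegral_indicator (hF _ hA),
    ← lintegral_indicator_one (hJ _ hB),
    ← lintegral_mul_eq_lintegral_mul_lintegral_of_independent_measurableSpace hF hJ hind
      (Measurable.indicator (m := mF) hf hA) (Measurable.indicator (m := mJ) h1 hB)]
  refine lintegral_congr fun ω => ?_
  by_cases h : ω ∈ A <;> by_cases h' : ω ∈ B <;> simp [h, h']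

/-- An identity of integrals over all sets of a sigma-algebra persists when that sigma-algebra is
enlarged by an independent one. -/
theorem setLIntegral_eq_of_indep {mH mF mJ : MeasurableSpace Ω} [mΩ : MeasurableSpace Ω]
    {μ : Measure Ω} (hHF : mH ≤ mF) (hF : mF ≤ mΩ) (hJ : mJ ≤ mΩ)
    (hind : Indep mF mJ μ) {f g : Ω → ENNReal} (hf : Measurable[mF] f) (hg : Measurable[mF] g)
    (hfin : ∫⁻ ω, f ω ∂μ ≠ ⊤)
    (hfg : ∀ B, MeasurableSet[mH] B → ∫⁻ ω in B, f ω ∂μ = ∫⁻ ω in B, g ω ∂μ)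
    {B : Set Ω} (hB : MeasurableSet[mH ⊔ mJ] B) :
    ∫⁻ ω in B, f ω ∂μ = ∫⁻ ω in B, g ω ∂μ := by
  have hle : mH ⊔ mJ ≤ mΩ := sup_le (hHF.trans hF) hJ
  -- The two integrals are compared as measures of `B`; uniqueness from a π-system of intersections
  -- needs finiteness, supplied by `hfin`.
  have : IsFiniteMeasure (μ.withDensity f) := isFiniteMeasure_withDensity hfin
  have key := ext_on_measurableSpace_of_generate_finite mΩ (μ := μ.withDensity f)
    (ν := μ.withDensity g) _ ?_ hle (sup_eq_generateFrom_inter mH mJ)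
    (isPiSystem_inter_measurableSet mH mJ) ?_ hB
  · rwa [withDensity_apply _ (hle _ hB), withDensity_apply _ (hle _ hB)] at key
  · rintro _ ⟨A₁, A₂, h₁, h₂, rfl⟩
    have hm : MeasurableSet (A₁ ∩ A₂) := (hF _ (hHF _ h₁)).inter (hJ _ h₂)
    rw [withDensity_apply _ hm, withDensity_apply _ hm,
      setLIntegral_inter_of_indep hF hJ hind hf (hHF _ h₁) h₂,
      setLIntegral_inter_of_indep hF hJ hind hg (hHF _ h₁) h₂, hfg _ h₁]
  · rw [withDensity_apply _ MeasurableSet.univ, withDensity_apply _ MeasurableSet.univ]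
    exact hfg _ MeasurableSet.univ

/-- Sigma-algebras generated by disjoint blocks of independent sigma-algebras are independent. -/
theorem iIndep_iSup_fiber {ι κ : Type*} {m : ι → MeasurableSpace Ω} [mΩ : MeasurableSpace Ω]
    {μ : Measure Ω} (hm : ∀ i, m i ≤ mΩ) (h : iIndep m μ) (b : ι → κ) :
    iIndep (fun k => ⨆ i ∈ b ⁻¹' {k}, m i) μ := by
  classical
  have := h.isProbabilityMeasure
  rw [iIndep_iff]
  intro S f hf
  induction S using Finset.induction_on with
  | empty => simp
  | insert a S ha ih =>
    rw [Finset.prod_insert ha, Finset.set_biInter_insert,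
      ← ih fun i hi => hf i (Finset.mem_insert_of_mem hi)]
    -- The block `a` is peeled off; the remaining events all lie in the sigma-algebra of the indices
    -- mapped into `S`.
    have hdisj : Disjoint (b ⁻¹' {a}) (b ⁻¹' (S : Set κ)) :=
      Disjoint.preimage _ (by simpa using ha)
    refine (Indep_iff _ _ _).1 (indep_iSup_of_disjoint hm h hdisj) _ _
      (hf a (Finset.mem_insert_self a S)) (Finset.measurableSet_biInter S fun k hk => ?_)
    have hle : (⨆ i ∈ b ⁻¹' {k}, m i) ≤ ⨆ i ∈ b ⁻¹' (S : Set κ), m i :=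
      biSup_mono fun i hi => by
        have : b i = k := hi
        simpa [this] using hk
    exact hle _ (hf k (Finset.mem_insert_of_mem hk))

/-- Two uncorrelated random measures, one of them without fixed atoms, almost surely have no common
atoms. -/
theorem ae_prod_diagonal_eq_zero [MeasurableSpace Ω] {μ : Measure Ω} (κ η : Kernel Ω ℝ)
    [IsSFiniteKernel κ] [IsSFiniteKernel η]
    (hκ : ∫⁻ ω, κ ω Set.univ ∂μ ≠ ⊤) (hη : ∫⁻ ω, η ω Set.univ ∂μ ≠ ⊤)
    (h : ∀ A B, MeasurableSet A → MeasurableSet B →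
      ∫⁻ ω, κ ω A * η ω B ∂μ = (∫⁻ ω, κ ω A ∂μ) * ∫⁻ ω, η ω B ∂μ)
    (hatom : ∀ t, ∫⁻ ω, η ω {t} ∂μ = 0) :
    ∀ᵐ ω ∂μ, (κ ω).prod (η ω) (Set.diagonal ℝ) = 0 := by
  have hbκ : ∀ A, MeasurableSet A → μ.bind κ A = ∫⁻ ω, κ ω A ∂μ := fun A hA =>
    Measure.bind_apply hA κ.measurable.aemeasurable
  have hbη : ∀ A, MeasurableSet A → μ.bind η A = ∫⁻ ω, η ω A ∂μ := fun A hA =>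
    Measure.bind_apply hA η.measurable.aemeasurable
  have : IsFiniteMeasure (μ.bind κ) := ⟨by rw [hbκ _ MeasurableSet.univ]; exact hκ.lt_top⟩
  have : IsFiniteMeasure (μ.bind η) := ⟨by rw [hbη _ MeasurableSet.univ]; exact hη.lt_top⟩
  -- The factorization on rectangles says that the mean of the product measures is the product of
  -- the mean measures. The diagonal is null for the latter because its sections are single points.
  have hprod : (μ.bind κ).prod (μ.bind η) = μ.bind (κ ×ₖ η) := by
    refine Measure.prod_eq fun A B hA hB => ?_
    rw [Measure.bind_apply (hA.prod hB) (κ ×ₖ η).measurable.aemeasurable, hbκ A hA, hbη B hB,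
      ← h A B hA hB]
    simp [Kernel.prod_apply]
  have hzero : (μ.bind κ).prod (μ.bind η) (Set.diagonal ℝ) = 0 := by
    rw [Measure.measure_prod_null measurableSet_diagonal]
    refine Eventually.of_forall fun t => ?_
    have : Prod.mk t ⁻¹' Set.diagonal ℝ = {t} := by ext; simp [eq_comm]
    simp only [this, Pi.zero_apply]
    rw [hbη _ (measurableSet_singleton t), hatom]
  rw [hprod, Measure.bind_apply measurableSet_diagonal (κ ×ₖ η).measurable.aemeasurable,
    lintegral_eq_zero_iff ((κ ×ₖ η).measurable_coe measurableSet_diagonal)] at hzero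
  filter_upwards [hzero] with ω hω
  simpa [Kernel.prod_apply] using hω

end Independence

/-! ### Pathwise behaviour of superposition. -/

section Superposition

variable {C M M' : ℕ}

theorem count_superposeEvents (P : Matrix (Fin M) (Fin M') ℕ) (s : Fin M → EventSeq C)
    (m' : Fin M') (c : Fin C) (t : ℝ) :
    (superposeEvents P s m').count c t = ∑ m, P m m' * (s m).count c t := by
  unfold EventSeq.count superposeEvents
  simp_rw [← Multiset.countP_eq_card_filter, ← Multiset.coe_countPAddMonoidHom, map_sum, map_nsmul,
    smul_eq_mul]

theorem measurable_count_superposeEvents {Ω : Type*} [MeasurableSpace Ω]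
    (P : Matrix (Fin M) (Fin M') ℕ) {N : Fin M → Ω → EventSeq C} {m' : Fin M'} {c : Fin C} {t : ℝ}
    (hN : ∀ m, P m m' ≠ 0 → Measurable fun ω => (N m ω).count c t) :
    Measurable fun ω => (superposeEvents P (fun m => N m ω) m').count c t := by
  simp_rw [count_superposeEvents]
  refine Finset.measurable_sum _ fun m _ => ?_
  by_cases h : P m m' = 0
  · simp only [h, zero_mul]
    exact measurable_const
  · exact (hN m h).const_mul _

theorem intensity_superposeEvents {L : ℕ} (H : HawkesModel C L M) (P : Matrix (Fin M) (Fin M') ℕ)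
    (s : Fin M → EventSeq C) (m' : Fin M') (c : Fin C) (t : ℝ) :
    (H.superpose P).intensity (superposeEvents P s m') m' c t =
      ∑ m, (P m m' : ℝ) * H.intensity (s m) m c t := by
  let φ : EventSeq C →+ ℝ :=
    { toFun := fun s => ((s.filter fun e => e.1 < t).map fun e => H.impact c e.2 (t - e.1)).sum
      map_zero' := by simp
      map_add' := fun a b => by simp [Multiset.filter_add] }
  have hφ : φ (superposeEvents P s m') = ∑ m, (P m m' : ℝ) * φ (s m) := by
    unfold superposeEvents
    simp_rw [map_sum, map_nsmul, nsmul_eq_mul]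
  change (H.U * P.map (Nat.cast : ℕ → ℝ)) c m' + φ (superposeEvents P s m') =
    ∑ m, (P m m' : ℝ) * (H.U c m + φ (s m))
  rw [hφ, Matrix.mul_apply, ← Finset.sum_add_distrib]
  exact Finset.sum_congr rfl fun m _ => by simp only [Matrix.map_apply]; ring

theorem mem_superposeEvents {P : Matrix (Fin M) (Fin M') ℕ} {s : Fin M → EventSeq C}
    {m' : Fin M'} {e : ℝ × Fin C} (he : e ∈ superposeEvents P s m') : ∃ m, e ∈ s m := by
  obtain ⟨m, -, hm⟩ := Multiset.mem_sum.1 he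
  exact ⟨m, Multiset.mem_of_mem_nsmul hm⟩

theorem nodup_map_superposeEvents {P : Matrix (Fin M) (Fin M') ℕ} (hP : ∀ m m', P m m' ≤ 1)
    {s : Fin M → EventSeq C} (hs : ∀ m, ((s m).map Prod.fst).Nodup)
    (hd : ∀ m n, m ≠ n → ∀ e ∈ s m, ∀ f ∈ s n, e.1 ≠ f.1) (m' : Fin M') :
    ((superposeEvents P s m').map Prod.fst).Nodup := by
  have hmap : (superposeEvents P s m').map Prod.fst = ∑ m, P m m' • (s m).map Prod.fst := by
    unfold superposeEvents
    simp_rw [← Multiset.coe_mapAddMonoidHom, map_sum, map_nsmul]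
  rw [hmap, Multiset.nodup_iff_count_le_one]
  intro a
  rw [Multiset.count_sum']
  simp_rw [Multiset.count_nsmul]
  by_cases h : ∃ m, a ∈ (s m).map Prod.fst
  · obtain ⟨m, hm⟩ := h
    rw [Finset.sum_eq_single_of_mem m (Finset.mem_univ m)]
    · exact mul_le_one' (hP m m') (Multiset.nodup_iff_count_le_one.1 (hs m) a)
    · intro n _ hn
      rw [Multiset.count_eq_zero_of_notMem, mul_zero]
      intro hn'
      obtain ⟨e, he, rfl⟩ := Multiset.mem_map.1 hm
      obtain ⟨f, hf, hfe⟩ := Multiset.mem_map.1 hn'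
      exact hd n m hn f hf e he hfe
  · push Not at h
    simp [Multiset.count_eq_zero_of_notMem (h _)]

end Superposition

/-! ### The superposed process is a Hawkes process. -/

namespace HawkesModel

variable {C L M M' K : ℕ} {Ω : Type*}

/-- The sigma-algebra generated by all counting functions of a random event sequence. -/
@[reducible] noncomputable def fullHistory (N : Ω → EventSeq C) : MeasurableSpace Ω :=
  MeasurableSpace.comap (fun ω (p : Fin C × ℝ) => (N ω).count p.1 p.2) inferInstance

theorem measurable_count_fullHistory (N : Ω → EventSeq C) (c : Fin C) (t : ℝ) :
    Measurable[fullHistory N] fun ω => (N ω).count c t :=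
  (measurable_pi_apply (c, t)).comp
    (comap_measurable fun ω (p : Fin C × ℝ) => (N ω).count p.1 p.2)

theorem eventHistory_le_fullHistory (N : Ω → EventSeq C) (t : ℝ) :
    eventHistory N t ≤ fullHistory N :=
  iSup_le fun c => iSup_le fun r => iSup_le fun _ =>
    (measurable_count_fullHistory N c r).comap_le

theorem measurable_count_eventHistory (N : Ω → EventSeq C) (c : Fin C) {r t : ℝ} (hr : r ≤ t) :
    Measurable[eventHistory N t] fun ω => (N ω).count c r :=
  Measurable.of_comap_le (le_iSup_of_le c (le_iSup_of_le r (le_iSup_of_le hr le_rfl)))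

theorem fullHistory_le [mΩ : MeasurableSpace Ω] {N : Ω → EventSeq C}
    (hN : ∀ c t, Measurable fun ω => (N ω).count c t) : fullHistory N ≤ mΩ :=
  Measurable.comap_le (measurable_pi_lambda _ fun p => hN p.1 p.2)

variable [MeasurableSpace Ω] {Pr : Measure Ω} {H : HawkesModel C L M} {T : ℝ}
  {N : Fin M → Ω → EventSeq C}

theorem IsHawkes.lintegral_timeMeasure_univ (hN : H.IsHawkes T N Pr) (m : Fin M) (c : Fin C) :
    ∫⁻ ω, (N m ω).timeMeasure c Set.univ ∂Pr = ∫⁻ ω, ((N m ω).count c T : ENNReal) ∂Pr := by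
  classical
  refine lintegral_congr_ae ?_
  filter_upwards [hN.mem_window m] with ω hω
  rw [← EventSeq.timeMeasure_Iic, EventSeq.timeMeasure_apply _ _ MeasurableSet.univ,
    EventSeq.timeMeasure_apply _ _ measurableSet_Iic]
  congr 2
  exact Multiset.filter_congr fun e he => by simp [(hω e he).2]

theorem IsHawkes.lintegral_timeMeasure_Ioc (hN : H.IsHawkes T N Pr) (m : Fin M) (c : Fin C)
    [SFinite Pr] {s t : ℝ} (hs : 0 ≤ s) (hst : s ≤ t) (ht : t ≤ T) :
    ∫⁻ ω, (N m ω).timeMeasure c (Set.Ioc s t) ∂Pr =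
      ∫⁻ u in Set.Ioc s t, ∫⁻ ω, ENNReal.ofReal (H.intensity (N m ω) m c u) ∂Pr := by
  simp_rw [EventSeq.timeMeasure_Ioc _ _ hst]
  have h := hN.has_intensity m c s t hs hst ht Set.univ MeasurableSet.univ
  simp only [Measure.restrict_univ] at h
  rw [h]
  exact lintegral_lintegral_swap
    (measurable_ofReal_intensity (hN.measurable_count m) H m c).aemeasurable

/-- Inside the window the mean measure has an integrable density, so the mass of `(s, t]` vanishes
as `s` increases to `t`. Outside the window there are almost surely no events. -/
theorem IsHawkes.lintegral_timeMeasure_singleton (hN : H.IsHawkes T N Pr) [SFinite Pr] (m : Fin M)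
    (c : Fin C) (t : ℝ) : ∫⁻ ω, (N m ω).timeMeasure c {t} ∂Pr = 0 := by
  classical
  by_cases ht : t ∈ Set.Ioc 0 T
  · set f : ℝ → ENNReal := fun u => ∫⁻ ω, ENNReal.ofReal (H.intensity (N m ω) m c u) ∂Pr
    have hT : 0 ≤ T := ht.1.le.trans ht.2
    have hfin : ∫⁻ u in Set.Ioc 0 T, f u ≠ ⊤ := by
      rw [← hN.lintegral_timeMeasure_Ioc m c le_rfl hT le_rfl]
      refine ne_top_of_le_ne_top (hN.finite_mean m c) ?_
      rw [← hN.lintegral_timeMeasure_univ m c]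
      exact lintegral_mono fun ω => measure_mono (Set.subset_univ _)
    have hvol : Tendsto ((volume.restrict (Set.Ioc 0 T)) ∘ fun s => Set.Ioc s t) (𝓝[<] t)
        (𝓝 0) := by
      have h1 : Tendsto (fun s => ENNReal.ofReal (t - s)) (𝓝[<] t) (𝓝 0) := by
        have : Tendsto (fun s => ENNReal.ofReal (t - s)) (𝓝 t) (𝓝 (ENNReal.ofReal (t - t))) :=
          (ENNReal.continuous_ofReal.comp (continuous_const.sub continuous_id)).tendsto t
        simp only [sub_self, ENNReal.ofReal_zero] at this
        exact this.mono_left nhdsWithin_le_nhds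
      refine tendsto_of_tendsto_of_tendsto_of_le_of_le tendsto_const_nhds h1 (fun _ => zero_le)
        fun s => ?_
      rw [← Real.volume_Ioc]
      exact Measure.restrict_apply_le _ _
    have hlim := tendsto_setLIntegral_zero hfin hvol
    refine le_antisymm (ge_of_tendsto hlim ?_) zero_le
    filter_upwards [Ico_mem_nhdsLT ht.1] with s hs
    rw [Measure.restrict_restrict_of_subset (Set.Ioc_subset_Ioc hs.1 ht.2),
      ← hN.lintegral_timeMeasure_Ioc m c hs.1 hs.2.le ht.2]
    exact lintegral_mono fun ω => measure_mono (Set.singleton_subset_iff.2 ⟨hs.2, le_rfl⟩)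
  · refine (lintegral_congr_ae (g := fun _ => 0) ?_).trans lintegral_zero
    filter_upwards [hN.mem_window m] with ω hω
    rw [EventSeq.timeMeasure_apply _ _ (measurableSet_singleton t)]
    have : (N m ω).filter (fun e => e.1 ∈ ({t} : Set ℝ) ∧ e.2 = c) = 0 :=
      Multiset.filter_eq_nil.2 fun e he h => ht (h.1 ▸ hω e he)
    rw [this, Multiset.card_zero, Nat.cast_zero]

/-- Different agents almost surely have no simultaneous events. -/
theorem IsHawkes.ae_times_ne (hN : H.IsHawkes T N Pr) [SFinite Pr] {m n : Fin M} (hmn : m ≠ n) :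
    ∀ᵐ ω ∂Pr, ∀ e ∈ N m ω, ∀ f ∈ N n ω, e.1 ≠ f.1 := by
  let κ : Fin M → Fin C → Kernel Ω ℝ := fun m c =>
    ⟨_, EventSeq.measurable_timeMeasure c (hN.measurable_count m c)⟩
  have hs : ∀ m c, IsSFiniteKernel (κ m c) := fun m c =>
    isSFiniteKernel_of_isFiniteMeasure _ fun ω =>
      inferInstanceAs (IsFiniteMeasure ((N m ω).timeMeasure c))
  have hfin : ∀ m c, ∫⁻ ω, κ m c ω Set.univ ∂Pr ≠ ⊤ := fun m c => by
    have := hN.lintegral_timeMeasure_univ m c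
    exact this.trans_ne (hN.finite_mean m c)
  have key : ∀ c c', ∀ᵐ ω ∂Pr, (κ m c ω).prod (κ n c' ω) (Set.diagonal ℝ) = 0 := by
    intro c c'
    refine ae_prod_diagonal_eq_zero _ _ (hfin m c) (hfin n c') (fun A B hA hB => ?_)
      (hN.lintegral_timeMeasure_singleton n c')
    have hm : ∀ m c A, MeasurableSet A → Measurable[fullHistory (N m)] fun ω => κ m c ω A :=
      fun m c A hA => by
        let _ := fullHistory (N m)
        exact (Measure.measurable_coe hA).comp (EventSeq.measurable_timeMeasure c
          (measurable_count_fullHistory (N m) c))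
    exact lintegral_mul_eq_lintegral_mul_lintegral_of_independent_measurableSpace
      (fullHistory_le (hN.measurable_count m)) (fullHistory_le (hN.measurable_count n))
      (hN.indep.iIndep.indep hmn) (hm m c A hA) (hm n c' B hB)
  filter_upwards [ae_all_iff.2 fun c => ae_all_iff.2 (key c)] with ω hω e he f hf hef
  -- A common event time would give the diagonal mass at least one.
  have h1 : (1 : ENNReal) ≤ (κ m e.2 ω).prod (κ n f.2 ω) ({e.1} ×ˢ {f.1}) := by
    rw [Measure.prod_prod]
    exact one_le_mul (EventSeq.one_le_timeMeasure he) (EventSeq.one_le_timeMeasure hf)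
  have h2 : ({e.1} ×ˢ {f.1} : Set (ℝ × ℝ)) ⊆ Set.diagonal ℝ := by
    rintro ⟨x, y⟩ ⟨hx, hy⟩
    exact (Set.mem_singleton_iff.1 hx).trans (hef.trans (Set.mem_singleton_iff.1 hy).symm)
  have h3 := h1.trans (measure_mono h2)
  rw [hω] at h3
  exact one_ne_zero (le_antisymm h3 zero_le)

/-- The compensator identity for one agent persists on the common history of all agents. -/
theorem IsHawkes.has_intensity_iSup (hN : H.IsHawkes T N Pr) (m : Fin M) (c : Fin C) {s t : ℝ}
    (hs : 0 ≤ s) (hst : s ≤ t) (ht : t ≤ T) {B : Set Ω}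
    (hB : MeasurableSet[⨆ n, eventHistory (N n) s] B) :
    ∫⁻ ω in B, (((N m ω).count c t - (N m ω).count c s : ℕ) : ENNReal) ∂Pr =
      ∫⁻ ω in B, (∫⁻ u in Set.Ioc s t, ENNReal.ofReal (H.intensity (N m ω) m c u)) ∂Pr := by
  have hle : ∀ n, fullHistory (N n) ≤ ‹MeasurableSpace Ω› := fun n =>
    fullHistory_le (hN.measurable_count n)
  have hind : Indep (fullHistory (N m)) (⨆ n ∈ ({m}ᶜ : Set (Fin M)), fullHistory (N n)) Pr := by
    have := indep_iSup_of_disjoint hle hN.indep.iIndep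
      (disjoint_compl_right (a := ({m} : Set (Fin M))))
    simpa using this
  refine setLIntegral_eq_of_indep (eventHistory_le_fullHistory (N m) s) (hle m)
    (iSup₂_le fun n _ => hle n) hind ?_ ?_ ?_ (hN.has_intensity m c s t hs hst ht) ?_
  · let _ := fullHistory (N m)
    exact (measurable_from_top (f := fun p : ℕ => (p : ENNReal))).comp
      ((measurable_count_fullHistory (N m) c t).sub (measurable_count_fullHistory (N m) c s))
  · let _ := fullHistory (N m)
    exact measurable_lintegral_intensity (measurable_count_fullHistory (N m)) H m c _
  · refine ne_top_of_le_ne_top (hN.finite_mean m c) (lintegral_mono fun ω => ?_)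
    exact Nat.cast_le.2 ((Nat.sub_le _ _).trans (EventSeq.count_mono _ _ ht))
  -- The past of agent `m` is kept as it is, while every other agent may contribute its full
  -- history, which is still independent of agent `m`.
  · refine (iSup_le fun n => ?_ : (⨆ n, eventHistory (N n) s) ≤ _) _ hB
    by_cases h : n = m
    · subst h
      exact le_sup_left
    · have h1 : fullHistory (N n) ≤ ⨆ k ∈ ({m}ᶜ : Set (Fin M)), fullHistory (N k) :=
        le_iSup₂_of_le n h le_rfl
      exact (eventHistory_le_fullHistory _ _).trans (h1.trans le_sup_right)

/-- The map `b` sends each agent to the new sequence that receives its events; its fibres are the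
disjoint blocks needed for independence. -/
theorem IsHawkes.superpose (hN : H.IsHawkes T N Pr) [SFinite Pr] {P : Matrix (Fin M) (Fin M') ℕ}
    (hP : ∀ m m', P m m' ≤ 1) (b : Fin M → Fin M') (hb : ∀ m m', P m m' ≠ 0 → b m = m') :
    (H.superpose P).IsHawkes T (fun m' ω => superposeEvents P (fun m => N m ω) m') Pr where
  measurable_count m' c t :=
    measurable_count_superposeEvents P fun m _ => hN.measurable_count m c t
  mem_window m' := by
    filter_upwards [ae_all_iff.2 hN.mem_window] with ω hω e he
    obtain ⟨m, hm⟩ := mem_superposeEvents he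
    exact hω m e hm
  simple m' := by
    filter_upwards [ae_all_iff.2 hN.simple, ae_all_iff.2 fun m => ae_all_iff.2 fun n =>
      ae_all_iff.2 fun h : m ≠ n => hN.ae_times_ne h] with ω h1 h2
    exact nodup_map_superposeEvents hP h1 h2 m'
  finite_mean m' c := by
    simp_rw [count_superposeEvents, Nat.cast_sum, Nat.cast_mul]
    have hmeas : ∀ m, Measurable fun ω => ((N m ω).count c T : ENNReal) := fun m =>
      (measurable_from_top (f := fun p : ℕ => (p : ENNReal))).comp (hN.measurable_count m c T)
    rw [lintegral_finsetSum _ fun m _ => (hmeas m).const_mul _]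
    refine ENNReal.sum_ne_top.2 fun m _ => ?_
    rw [lintegral_const_mul _ (hmeas m)]
    exact ENNReal.mul_ne_top (ENNReal.natCast_ne_top _) (hN.finite_mean m c)
  has_intensity m' c s t hs hst ht B hB := by
    have hle : eventHistory (fun ω => superposeEvents P (fun m => N m ω) m') s ≤
        ⨆ n, eventHistory (N n) s := by
      refine iSup_le fun c => iSup_le fun r => iSup_le fun hr => Measurable.comap_le ?_
      let _ : MeasurableSpace Ω := ⨆ n, eventHistory (N n) s
      exact measurable_count_superposeEvents P fun m _ =>
        (measurable_count_eventHistory (N m) c hr).mono (le_iSup_of_le m le_rfl) le_rfl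
    have hcount : ∀ ω, (((superposeEvents P (fun m => N m ω) m').count c t -
        (superposeEvents P (fun m => N m ω) m').count c s : ℕ) : ENNReal) =
        ∑ m, (P m m' : ENNReal) * (((N m ω).count c t - (N m ω).count c s : ℕ) : ENNReal) := by
      intro ω
      rw [count_superposeEvents, count_superposeEvents,
        -- Natural subtraction commutes with the sum because each count is monotone in time.
        ← Finset.sum_tsub_distrib _ fun m _ =>
          Nat.mul_le_mul_left _ (EventSeq.count_mono (N m ω) c hst)]
      push_cast [← Nat.mul_sub]
      rfl
    have hint : ∀ ω, ∫⁻ u in Set.Ioc s t, ENNReal.ofReal ((H.superpose P).intensity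
        (superposeEvents P (fun m => N m ω) m') m' c u) =
        ∑ m, (P m m' : ENNReal) *
          ∫⁻ u in Set.Ioc s t, ENNReal.ofReal (H.intensity (N m ω) m c u) := by
      intro ω
      have hmeas : ∀ m, Measurable fun u => ENNReal.ofReal (H.intensity (N m ω) m c u) := fun m =>
        H.measurable_ofReal_intensity_time (N m ω) m c
      have hsum : ∀ u, ENNReal.ofReal ((H.superpose P).intensity
          (superposeEvents P (fun m => N m ω) m') m' c u) =
          ∑ m, (P m m' : ENNReal) * ENNReal.ofReal (H.intensity (N m ω) m c u) := by
        intro u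
        rw [intensity_superposeEvents, ENNReal.ofReal_sum_of_nonneg fun m _ =>
          mul_nonneg (Nat.cast_nonneg (P m m')) (H.intensity_nonneg (N m ω) m c u)]
        refine Finset.sum_congr rfl fun m _ => ?_
        rw [ENNReal.ofReal_mul (Nat.cast_nonneg _), ENNReal.ofReal_natCast]
      rw [lintegral_congr hsum, lintegral_finsetSum _ fun m _ => (hmeas m).const_mul _]
      exact Finset.sum_congr rfl fun m _ => lintegral_const_mul _ (hmeas m)
    simp_rw [hcount, hint]
    have hm1 : ∀ m, Measurable fun ω =>
        (((N m ω).count c t - (N m ω).count c s : ℕ) : ENNReal) := fun m =>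
      (measurable_from_top (f := fun p : ℕ => (p : ENNReal))).comp
        ((hN.measurable_count m c t).sub (hN.measurable_count m c s))
    have hm2 : ∀ m, Measurable fun ω =>
        ∫⁻ u in Set.Ioc s t, ENNReal.ofReal (H.intensity (N m ω) m c u) := fun m =>
      measurable_lintegral_intensity (hN.measurable_count m) H m c _
    rw [lintegral_finsetSum _ fun m _ => (hm1 m).const_mul _,
      lintegral_finsetSum _ fun m _ => (hm2 m).const_mul _]
    refine Finset.sum_congr rfl fun m _ => ?_
    rw [lintegral_const_mul _ (hm1 m), lintegral_const_mul _ (hm2 m),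
      hN.has_intensity_iSup m c hs hst ht (hle _ hB)]
  indep := by
    have hblock := iIndep_iSup_fiber (fun m => fullHistory_le (hN.measurable_count m))
      hN.indep.iIndep b
    refine iIndep_of_iIndep_of_le hblock fun m' => ?_
    let _ : MeasurableSpace Ω := ⨆ i ∈ b ⁻¹' {m'}, fullHistory (N i)
    refine Measurable.comap_le (measurable_pi_lambda _ fun p => ?_)
    exact measurable_count_superposeEvents P fun m h =>
      (measurable_count_fullHistory (N m) p.1 p.2).mono (le_iSup₂_of_le m (hb m m' h) le_rfl) le_rfl

end HawkesModel

/-! ### Norms and risk bounds under superposition. -/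

section Superposition

variable {C L M M' K : ℕ}

theorem IsNonaugmented.le_one {P : Matrix (Fin M) (Fin M') ℕ} (hP : IsNonaugmented P K)
    (m : Fin M) (m' : Fin M') : P m m' ≤ 1 := by
  rcases hP.binary m m' with h | h <;> simp [h]

theorem IsNonaugmented.sum_row {P : Matrix (Fin M) (Fin M') ℕ} (hP : IsNonaugmented P K)
    (m : Fin M) : ∑ m', P m m' = 1 := by
  simpa [Matrix.mulVec, dotProduct] using congrFun hP.row_sums m

theorem IsNonaugmented.sum_col_le {P : Matrix (Fin M) (Fin M') ℕ} (hP : IsNonaugmented P K)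
    (m' : Fin M') : ∑ m, P m m' ≤ K := by
  have := hP.col_sums.2 ⟨m', rfl⟩
  simpa [Matrix.vecMul, dotProduct] using this

theorem IsNonaugmented.exists_block {P : Matrix (Fin M) (Fin M') ℕ} (hP : IsNonaugmented P K) :
    ∃ b : Fin M → Fin M', ∀ m m', P m m' ≠ 0 → b m = m' := by
  have h1 : ∀ m, ∃ m', P m m' ≠ 0 := fun m => by
    by_contra! h
    have := hP.sum_row m
    simp [h] at this
  choose b hb using h1
  refine ⟨b, fun m m' h => by_contra fun hne => ?_⟩
  -- Two nonzero natural entries in a row would already sum to at least two.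
  have h2 := Finset.sum_le_sum_of_subset (f := P m) (Finset.subset_univ {b m, m'})
  rw [Finset.sum_pair hne, hP.sum_row m] at h2
  have := Nat.pos_of_ne_zero (hb m)
  have := Nat.pos_of_ne_zero h
  omega

theorem IsNonaugmented.pos {P : Matrix (Fin M) (Fin M') ℕ} (hP : IsNonaugmented P K)
    (hM : 0 < M) : 0 < K := by
  obtain ⟨b, -⟩ := hP.exists_block
  have h1 : ∃ m', P ⟨0, hM⟩ m' ≠ 0 := by
    by_contra! h
    have := hP.sum_row ⟨0, hM⟩
    simp [h] at this
  obtain ⟨m', h⟩ := h1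
  have := Finset.single_le_sum (f := fun m => P m m') (fun m _ => Nat.zero_le _)
    (Finset.mem_univ (⟨0, hM⟩ : Fin M))
  exact (Nat.pos_of_ne_zero h).trans_le (this.trans (hP.sum_col_le m'))

theorem IsNonaugmented.pos_right {P : Matrix (Fin M) (Fin M') ℕ} (hP : IsNonaugmented P K) :
    0 < M' := by
  obtain ⟨m', -⟩ := hP.col_sums.1
  exact m'.pos

theorem card_superposeEvents (P : Matrix (Fin M) (Fin M') ℕ) (s : Fin M → EventSeq C)
    (m' : Fin M') :
    Multiset.card (superposeEvents P s m') = ∑ m, P m m' * Multiset.card (s m) := by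
  simp [superposeEvents]

theorem totalEvents_superposeEvents {P : Matrix (Fin M) (Fin M') ℕ} (hP : IsNonaugmented P K)
    (s : Fin M → EventSeq C) : totalEvents (superposeEvents P s) = totalEvents s := by
  unfold totalEvents
  simp_rw [card_superposeEvents]
  rw [Finset.sum_comm]
  simp_rw [← Finset.sum_mul, hP.sum_row, one_mul]

theorem card_le_maxEvents (s : Fin M → EventSeq C) (m : Fin M) :
    Multiset.card (s m) ≤ maxEvents s :=
  Finset.le_sup (f := fun m => Multiset.card (s m)) (Finset.mem_univ m)

theorem maxEvents_superposeEvents_le {P : Matrix (Fin M) (Fin M') ℕ} (hP : IsNonaugmented P K)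
    (s : Fin M → EventSeq C) : maxEvents (superposeEvents P s) ≤ K * maxEvents s := by
  refine Finset.sup_le fun m' _ => ?_
  rw [card_superposeEvents]
  calc ∑ m, P m m' * Multiset.card (s m) ≤ ∑ m, P m m' * maxEvents s :=
        Finset.sum_le_sum fun m _ => Nat.mul_le_mul_left _ (card_le_maxEvents s m)
    _ = (∑ m, P m m') * maxEvents s := (Finset.sum_mul _ _ _).symm
    _ ≤ K * maxEvents s := Nat.mul_le_mul_right _ (hP.sum_col_le m')

/-- Merging at most `K` sequences multiplies the maximal length by at most `K`, which the new lower
bound `K * lam0` offsets. -/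
theorem smoothness_superposeEvents_le {P : Matrix (Fin M) (Fin M') ℕ} (hP : IsNonaugmented P K)
    (hK : 0 < K) (s : Fin M → EventSeq C) (G : ℝ) {lam0 : ℝ} (hlam0 : 0 < lam0) :
    smoothness L (superposeEvents P s) G (K * lam0) ≤ smoothness L s G lam0 := by
  have hK' : (0 : ℝ) < K := Nat.cast_pos.2 hK
  have h : (maxEvents (superposeEvents P s) : ℝ) / K ≤ maxEvents s := by
    rw [div_le_iff₀ hK', mul_comm]
    exact_mod_cast maxEvents_superposeEvents_le hP s
  have e : (L * G * maxEvents (superposeEvents P s) / (K * lam0) : ℝ) =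
      L * G / lam0 * (maxEvents (superposeEvents P s) / K) := by
    field_simp
  have e' : (L * G * maxEvents s / lam0 : ℝ) = L * G / lam0 * maxEvents s := by ring
  unfold smoothness
  rw [e, e', mul_pow, mul_pow]
  gcongr

theorem frobSq_nonneg (U : Matrix (Fin C) (Fin M) ℝ) : 0 ≤ frobSq U :=
  Finset.sum_nonneg fun _ _ => Finset.sum_nonneg fun _ _ => sq_nonneg _

/-- Expanding a squared column of `U P`, orthogonality leaves only diagonal terms, weighted by `P m
m'` since a binary entry equals its square. Row sums one then count each agent exactly once. -/
theorem HawkesModel.frobSq_superpose {H : HawkesModel C L M} (horth : H.OrthogonalExogenous)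
    {P : Matrix (Fin M) (Fin M') ℕ} (hP : IsNonaugmented P K) :
    frobSq (H.superpose P).U = frobSq H.U := by
  have hsq : ∀ m m', (P m m' : ℝ) * P m m' = P m m' := fun m m' => by
    rcases hP.binary m m' with h | h <;> simp [h]
  have hrow : ∀ m, ∑ m', (P m m' : ℝ) = 1 := fun m => by exact_mod_cast hP.sum_row m
  have hcol : ∀ m', ∑ c, (H.superpose P).U c m' ^ 2 = ∑ m, (P m m' : ℝ) * ∑ c, H.U c m ^ 2 := by
    intro m'
    calc ∑ c, (H.superpose P).U c m' ^ 2
        = ∑ c, ∑ m, ∑ n, (P m m' : ℝ) * P n m' * (H.U c m * H.U c n) := by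
          refine Finset.sum_congr rfl fun c _ => ?_
          change ((H.U * P.map (Nat.cast : ℕ → ℝ)) c m') ^ 2 = _
          rw [Matrix.mul_apply, sq, Finset.sum_mul_sum]
          refine Finset.sum_congr rfl fun m _ => Finset.sum_congr rfl fun n _ => ?_
          simp only [Matrix.map_apply]
          ring
      _ = ∑ m, ∑ n, (P m m' : ℝ) * P n m' * ∑ c, H.U c m * H.U c n := by
          rw [Finset.sum_comm]
          refine Finset.sum_congr rfl fun m _ => ?_
          rw [Finset.sum_comm]
          simp_rw [Finset.mul_sum]
      _ = ∑ m, (P m m' : ℝ) * ∑ c, H.U c m ^ 2 := by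
          refine Finset.sum_congr rfl fun m _ => ?_
          rw [Finset.sum_eq_single_of_mem m (Finset.mem_univ m), hsq]
          · simp_rw [sq]
          · intro n _ hn
            have : ∑ c, H.U c m * H.U c n = 0 := horth m n hn.symm
            rw [this, mul_zero]
  unfold frobSq
  rw [Finset.sum_comm]
  simp_rw [hcol]
  rw [Finset.sum_comm]
  simp_rw [← Finset.sum_mul, hrow, one_mul]
  exact Finset.sum_comm

theorem HawkesModel.BoundedBy.nonneg {H : HawkesModel C L M} {T U0 A0 G : ℝ}
    (h : H.BoundedBy T U0 A0 G) : 0 ≤ U0 + A0 :=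
  add_nonneg ((frobSq_nonneg _).trans h.U_le) (le_trans (Finset.sum_nonneg fun _ _ =>
    Finset.sum_nonneg fun _ _ => Finset.sum_nonneg fun _ _ => sq_nonneg _) h.A_le)

theorem HawkesModel.BoundedBy.superpose {H : HawkesModel C L M} {T U0 A0 G : ℝ}
    (h : H.BoundedBy T U0 A0 G) (horth : H.OrthogonalExogenous)
    {P : Matrix (Fin M) (Fin M') ℕ} (hP : IsNonaugmented P K) :
    (H.superpose P).BoundedBy T U0 A0 G :=
  ⟨(frobSq_superpose horth hP).le.trans h.U_le, h.A_le, h.g_le⟩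

/-- The ratio of dimension terms is at least one because `M' ≤ M`; `log (2 / δ) > 0` keeps the
denominator positive even if `log n = 0`. -/
theorem tighteningCondition_self {n : ℕ} {U0 A0 δ : ℝ} (hM : M' ≤ M) (hR : 0 ≤ U0 + A0)
    (hδ : 0 < Real.log (2 / δ)) : TighteningCondition C L M M' n U0 U0 A0 δ := by
  unfold TighteningCondition
  have hn : 0 ≤ Real.log n := Real.log_natCast_nonneg n
  have h : 1 ≤ ((M + C * L : ℕ) * Real.log n + Real.log (2 / δ)) /
      ((M' + C * L : ℕ) * Real.log n + Real.log (2 / δ)) := by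
    rw [one_le_div (by positivity)]
    gcongr
  nlinarith

theorem riskBound_superposeEvents_le {P : Matrix (Fin M) (Fin M') ℕ} (hP : IsNonaugmented P K)
    (hK : 0 < K) (hM : M' ≤ M) (s : Fin M → EventSeq C) {U0 A0 G lam0 δ : ℝ}
    (hlam0 : 0 < lam0) (hR : 0 ≤ U0 + A0) (hδ : 0 < Real.log (2 / δ)) :
    riskBound L (superposeEvents P s) U0 A0 G (K * lam0) δ ≤ riskBound L s U0 A0 G lam0 δ := by
  unfold riskBound
  rw [totalEvents_superposeEvents hP]
  have hn : 0 ≤ Real.log (totalEvents s) := Real.log_natCast_nonneg _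
  have hτ : 0 ≤ smoothness L s G lam0 := sq_nonneg _
  have hD : paramDim C L M' ≤ paramDim C L M := by unfold paramDim; gcongr
  gcongr
  exact smoothness_superposeEvents_le hP hK s G hlam0

/-- Strictness comes from the dimension alone, as the smoothness constant may stay the same. The
other factors must therefore be positive, including `log` of the number of events. -/
theorem riskBound_superposeEvents_lt {P : Matrix (Fin M) (Fin M') ℕ} (hP : IsNonaugmented P K)
    (hK : 0 < K) (hM : M' < M) {s : Fin M → EventSeq C} (hs : 2 ≤ totalEvents s) (hL : 0 < L)
    {U0 A0 G lam0 δ : ℝ} (hG : 0 < G) (hlam0 : 0 < lam0) (hR : 0 < U0 + A0)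
    (hδ : 0 < Real.log (2 / δ)) :
    riskBound L (superposeEvents P s) U0 A0 G (K * lam0) δ < riskBound L s U0 A0 G lam0 δ := by
  obtain ⟨m, hm⟩ : ∃ m, Multiset.card (s m) ≠ 0 := by
    by_contra! h
    simp [totalEvents, h] at hs
  -- An event carries an entity, which forces `C > 0`.
  obtain ⟨e, -⟩ := Multiset.card_pos_iff_exists_mem.1 (Nat.pos_of_ne_zero hm)
  have hC : 0 < C := e.2.pos
  have hI : (0 : ℝ) < maxEvents s :=
    Nat.cast_pos.2 ((Nat.pos_of_ne_zero hm).trans_le (card_le_maxEvents s m))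
  have hL' : (0 : ℝ) < L := Nat.cast_pos.2 hL
  have hτ : 0 < smoothness L s G lam0 := by unfold smoothness; positivity
  have hn : 0 < Real.log (totalEvents s) := Real.log_pos (by exact_mod_cast hs)
  have hn' : (0 : ℝ) < totalEvents s := by exact_mod_cast (by omega : 0 < totalEvents s)
  have hD : paramDim C L M' < paramDim C L M := by
    unfold paramDim
    exact Nat.mul_lt_mul_of_pos_left (by omega) hC
  unfold riskBound
  rw [totalEvents_superposeEvents hP]
  refine div_lt_div_of_pos_right ?_ hn'
  calc (U0 + A0) * smoothness L (superposeEvents P s) G (K * lam0) *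
        (paramDim C L M' * Real.log (totalEvents s) + Real.log (2 / δ))
      ≤ (U0 + A0) * smoothness L s G lam0 *
        (paramDim C L M' * Real.log (totalEvents s) + Real.log (2 / δ)) := by
        gcongr
        exact smoothness_superposeEvents_le hP hK s G hlam0
    _ < _ := by gcongr

theorem HawkesModel.le_intensity_superposeEvents (H : HawkesModel C L M)
    {P : Matrix (Fin M) (Fin M') ℕ} {s : Fin M → EventSeq C} {lam0 t : ℝ} {c : Fin C}
    (h : ∀ m, lam0 ≤ H.intensity (s m) m c t) {m' : Fin M'} (hK : ∑ m, P m m' = K) :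
    K * lam0 ≤ (H.superpose P).intensity (superposeEvents P s m') m' c t := by
  rw [intensity_superposeEvents, ← hK, Nat.cast_sum, Finset.sum_mul]
  exact Finset.sum_le_sum fun m _ => mul_le_mul_of_nonneg_left (h m) (Nat.cast_nonneg _)

end Superposition

theorem corollary2 {C L M M' K : ℕ} {Ω : Type*} [MeasurableSpace Ω]
    (Pr : Measure Ω) [IsProbabilityMeasure Pr]
    (H : HawkesModel C L M) (T : ℝ) (N : Fin M → Ω → EventSeq C)
    (hN : H.IsHawkes T N Pr)
    (horth : H.OrthogonalExogenous)
    (P : Matrix (Fin M) (Fin M') ℕ) (hP : IsNonaugmented P K) (hM : M' ≤ M)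
    (U0 A0 G lam0 δ : ℝ) (hbd : H.BoundedBy T U0 A0 G) (hlam0 : 0 < lam0)
    (hδ : 0 < δ) (hδ' : δ < 1 / 2) :
    -- the superposed sequences form an `M'`-agent Hawkes process with parameters `U P` and `A`
    (H.superpose P).IsHawkes T (fun m' ω => superposeEvents P (fun m => N m ω) m') Pr ∧
    -- the exogenous intensities keep their norm, so the same bounds on the parameters are valid
    frobSq (H.superpose P).U = frobSq H.U ∧
    (H.superpose P).BoundedBy T U0 A0 G ∧
    -- if every new sequence merges `K` old ones, lower bounds on the intensities scale by `K`
    ((∀ m', ∑ m, P m m' = K) → ∀ ω t c,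
      (∀ m, lam0 ≤ H.intensity (N m ω) m c t) →
      ∀ m', K * lam0 ≤
        (H.superpose P).intensity (superposeEvents P (fun m => N m ω) m') m' c t) ∧
    -- for every realization, the condition for tightening holds and the risk bound is tighter
    ∀ ω,
      TighteningCondition C L M M' (totalEvents fun m => N m ω) U0 U0 A0 δ ∧
      riskBound L (superposeEvents P fun m => N m ω) U0 A0 G (K * lam0) δ ≤
        riskBound L (fun m => N m ω) U0 A0 G lam0 δ ∧
      (M' < M → 2 ≤ (totalEvents fun m => N m ω) → 0 < L → 0 < G → 0 < U0 + A0 →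
        riskBound L (superposeEvents P fun m => N m ω) U0 A0 G (K * lam0) δ <
          riskBound L (fun m => N m ω) U0 A0 G lam0 δ) := by
  have hlog : 0 < Real.log (2 / δ) := Real.log_pos (by rw [lt_div_iff₀ hδ]; linarith)
  -- A largest column sum is attained, so there is a column; then `M' ≤ M` provides an agent, and
  -- its row puts a one in some column.
  have hK : 0 < K := hP.pos (hP.pos_right.trans_le hM)
  obtain ⟨b, hb⟩ := hP.exists_block
  exact ⟨hN.superpose hP.le_one b hb, HawkesModel.frobSq_superpose horth hP,
    hbd.superpose horth hP,
    fun hcol ω t c h m' => H.le_intensity_superposeEvents h (hcol m'),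
    fun ω => ⟨tighteningCondition_self hM hbd.nonneg hlog,
      riskBound_superposeEvents_le hP hK hM _ hlam0 hbd.nonneg hlog,
      fun hM' hs hL hG hR => riskBound_superposeEvents_lt hP hK hM' hs hL hG hlam0 hR hlog⟩⟩
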